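/- All graphs are finite and simple. A burning process of a connected graph $G$ is the following: initially all vertices are unburned; in each round $r\ge 1$ one chooses a vertex $x_r$ that is unburned at the end of round $r-1$ (the source of round $r$), and burns $x_r$ together with all unburned vertices that are adjacent to some vertex burned by the end of round $r-1$; burned vertices remain burned, and the process terminates as soon as all vertices are burned. If it terminates in $k$ rounds, $(x_1,\dots,x_k)$ is called a burning sequence of length $k$ for $G$. The burning number $b(G)$ is the minimum length of a burning sequence for $G$. **Proposition.** Let $m$ be a non-negative integer and let $T$ be a tree of order $n\ge m(m+1)+1$ with no vertex of degree 2. Then $$b(T)\le \left\lceil (n-m)^{\frac12}\right\rceil .$$ -/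

import Mathlib

namespace SimpleGraph

variable {V : Type*}

/-- The set of burned vertices after `r` rounds, when the source of round `i + 1` is `x i` (so the
rounds are counted from `1` and the sources are indexed from `0`). In each round, the source of
that round and all neighbours of the already burned vertices become burned, and burned vertices
remain burned. -/
def burned (G : SimpleGraph V) {k : ℕ} (x : Fin k → V) : ℕ → Set V
  | 0 => ∅
  | r + 1 => burned G x r ∪ {v | ∃ u ∈ burned G x r, G.Adj u v} ∪ {v | ∃ i : Fin k, i.val = r ∧ x i = v}

/-- `x` is a burning sequence of length `k` for `G`: every source is unburned when it is chosen, and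
all vertices are burned after `k` rounds. (The process cannot have terminated before round `k`,
since the source of round `k` is unburned after round `k - 1`.) -/
def IsBurningSequence (G : SimpleGraph V) {k : ℕ} (x : Fin k → V) : Prop :=
  (∀ i : Fin k, x i ∉ G.burned x i) ∧ G.burned x k = Set.univ

/-- The burning number: the minimum length of a burning sequence. -/
noncomputable def burningNumber (G : SimpleGraph V) : ℕ :=
  sInf {k | ∃ x : Fin k → V, G.IsBurningSequence x}

theorem burned_mono (G : SimpleGraph V) {k : ℕ} (x : Fin k → V) : Monotone (G.burned x) :=
  monotone_nat_of_le_succ fun _ _ hv => Or.inl (Or.inl hv)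

theorem burned_snoc (G : SimpleGraph V) {k : ℕ} (x : Fin k → V) (w : V) {r : ℕ} (hr : r ≤ k) :
    G.burned (Fin.snoc x w : Fin (k + 1) → V) r = G.burned x r := by
  induction r with
  | zero => rfl
  | succ r ih =>
    have h : {v | ∃ i : Fin (k + 1), i.val = r ∧ (Fin.snoc x w : Fin (k + 1) → V) i = v} =
        {v | ∃ i : Fin k, i.val = r ∧ x i = v} := by
      ext v
      constructor
      · rintro ⟨i, hi, hv⟩
        refine ⟨⟨r, hr⟩, rfl, ?_⟩
        have : i = Fin.castSucc ⟨r, hr⟩ := Fin.ext hi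
        rw [this, Fin.snoc_castSucc] at hv
        exact hv
      · rintro ⟨i, hi, hv⟩
        exact ⟨i.castSucc, hi, by rw [Fin.snoc_castSucc]; exact hv⟩
    rw [burned, burned, ih (by omega), h]

/-- Every finite graph has a burning sequence, so the minimum in `burningNumber` is over a nonempty
set. -/
theorem exists_isBurningSequence [Finite V] (G : SimpleGraph V) :
    ∃ (k : ℕ) (x : Fin k → V), G.IsBurningSequence x := by
  by_contra hcon
  push Not at hcon
  have key : ∀ k : ℕ, ∃ x : Fin k → V, ∀ i : Fin k, x i ∉ G.burned x i := by
    intro k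
    induction k with
    | zero => exact ⟨Fin.elim0, fun i => i.elim0⟩
    | succ k ih =>
      obtain ⟨x, hx⟩ := ih
      have h : G.burned x k ≠ Set.univ := fun h => hcon k x ⟨hx, h⟩
      obtain ⟨w, hw⟩ := (Set.ne_univ_iff_exists_notMem _).1 h
      refine ⟨Fin.snoc x w, fun i => ?_⟩
      rw [burned_snoc G x w (Nat.lt_succ_iff.1 i.2)]
      refine Fin.lastCases ?_ (fun j => ?_) i
      · simpa using hw
      · simpa using hx j
  obtain ⟨x, hx⟩ := key (Nat.card V + 1)
  have hlt : ∀ i j, i < j → x i ≠ x j := by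
    intro i j hij h
    refine hx j (G.burned_mono x (Nat.succ_le_of_lt hij) ?_)
    exact Or.inr ⟨i, rfl, h⟩
  have hinj : Function.Injective x := by
    intro i j h
    rcases lt_trichotomy i j with h' | h' | h'
    · exact absurd h (hlt i j h')
    · exact h'
    · exact absurd h.symm (hlt j i h')
  have := Nat.card_le_card_of_injective x hinj
  simp at this

end SimpleGraph

/-! Burning from sources `x₁, …, x_k` burns the balls of radii `k - 1, …, 0` around them, so the
theorem asks for a cover of `T` by balls of radii `0, …, k - 1`. A connected graph on at most
`∑ (rᵢ + 1) + rⱼ` vertices is covered by balls of radii `rᵢ`: fix a root and let `x` lie `rᵢ`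
levels above a deepest vertex on a geodesic; the vertices that a geodesic from the root reaches
through `x` number at least `rᵢ + 1`, lie in the ball of radius `rᵢ` around `x`, and can be deleted
without disconnecting the rest. The last ball suffices for `2 rⱼ + 1` vertices. A tree with
`2 ≤ n < k (k + 1)` vertices, none of degree two, has at most `n / 2 - 1` inner vertices. If
there are any, the bound for radii `0, …, k - 2` covers them, and enlarging every radius by one
reaches the leaves. Finally `k ^ 2 ≥ n - m` and `n > m (m + 1)` force `m < k`, hence
`n < k (k + 1)`. -/

namespace GraphBurning

open SimpleGraph Finset

section Distance

variable {V : Type*} {G : SimpleGraph V}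

theorem exists_adj_dist_add_one_eq {a b : V} (h : G.dist a b ≠ 0) :
    ∃ c, G.Adj c b ∧ G.dist a c + 1 = G.dist a b := by
  rw [dist_comm] at h
  obtain ⟨p, hp⟩ := exists_walk_of_dist_ne_zero h
  cases p with
  | nil => simp at h
  | @cons _ c _ hadj q =>
    refine ⟨c, hadj.symm, ?_⟩
    have hq : G.dist c a ≤ q.length := dist_le q
    have hstep := hadj.diff_dist_adj (u := a)
    rw [Walk.length_cons, dist_comm] at hp
    rw [dist_comm] at hq
    omega

theorem dist_le_dist_induce {S : Set V} {a b : S} (h : (G.induce S).Reachable a b) :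
    G.dist a b ≤ (G.induce S).dist a b := by
  obtain ⟨p, hp⟩ := h.exists_walk_length_eq_dist
  rw [← hp, ← Walk.length_map (Embedding.induce S).toHom p]
  exact dist_le _

theorem induce_connected_of_forall_exists_adj_lt (f : V → ℕ) {S : Set V} {ρ : V} (hρ : ρ ∈ S)
    (hf : ∀ w ∈ S, w ≠ ρ → ∃ w' ∈ S, G.Adj w' w ∧ f w' < f w) : (G.induce S).Connected := by
  refine (connected_iff_exists_forall_reachable _).2 ⟨⟨ρ, hρ⟩, fun w => ?_⟩
  induction w using (measure fun w : S => f w).wf.induction with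
  | _ w ih =>
    by_cases hw : (w : V) = ρ
    · obtain rfl : w = ⟨ρ, hρ⟩ := Subtype.ext hw
      exact Reachable.refl _
    · obtain ⟨w', hw', hadj, hlt⟩ := hf w w.2 hw
      have hadj' : (G.induce S).Adj ⟨w', hw'⟩ w := hadj
      exact (ih ⟨w', hw'⟩ hlt).trans hadj'.reachable

end Distance

section GeodesicCone

variable {V : Type*} {G : SimpleGraph V} {ρ v : V}

/-- The vertices that `ρ` can reach by a geodesic through `v`. In a tree these are the descendants
of `v` with respect to the root `ρ`. The graph is meant to be connected, since `SimpleGraph.dist`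
is `0` between different components. -/
def geodesicCone (G : SimpleGraph V) (ρ v : V) : Set V :=
  {w | G.dist ρ w = G.dist ρ v + G.dist v w}

theorem mem_geodesicCone {w : V} :
    w ∈ geodesicCone G ρ v ↔ G.dist ρ w = G.dist ρ v + G.dist v w :=
  Iff.rfl

theorem self_mem_geodesicCone (G : SimpleGraph V) (ρ v : V) : v ∈ geodesicCone G ρ v := by
  simp [mem_geodesicCone]

theorem geodesicCone_ssubset_of_adj (hG : G.Connected) {u : V} (hadj : G.Adj u v)
    (hdist : G.dist ρ u + 1 = G.dist ρ v) : geodesicCone G ρ v ⊂ geodesicCone G ρ u := by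
  refine Set.ssubset_iff_of_subset (fun w hw => ?_) |>.2 ⟨u, self_mem_geodesicCone G ρ u, ?_⟩
  · have hstep := hadj.diff_dist_adj (u := w)
    have htri := hG.dist_triangle (u := ρ) (v := u) (w := w)
    rw [dist_comm (u := w), dist_comm (u := w)] at hstep
    rw [mem_geodesicCone] at hw ⊢
    omega
  · rw [mem_geodesicCone]
    omega

theorem exists_lt_ncard_geodesicCone [Finite V] (hG : G.Connected) {u : V} {r : ℕ}
    (hr : r ≤ G.dist ρ u) :
    ∃ v, G.dist ρ v + r = G.dist ρ u ∧ r < (geodesicCone G ρ v).ncard := by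
  induction r with
  | zero => exact ⟨u, rfl, (Set.ncard_pos (Set.toFinite _)).2 ⟨u, self_mem_geodesicCone G ρ u⟩⟩
  | succ r ih =>
    obtain ⟨v, hv, hcard⟩ := ih (by omega)
    obtain ⟨v', hadj, hdist⟩ := exists_adj_dist_add_one_eq (G := G) (a := ρ) (b := v) (by omega)
    have hlt := Set.ncard_lt_ncard (geodesicCone_ssubset_of_adj hG hadj hdist)
    exact ⟨v', by omega, by omega⟩

theorem induce_compl_geodesicCone_connected (hG : G.Connected) (hne : ρ ≠ v) :
    (G.induce (geodesicCone G ρ v)ᶜ).Connected := by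
  refine induce_connected_of_forall_exists_adj_lt (G.dist ρ) (ρ := ρ) ?_ fun w hw hwρ => ?_
  · have hpos := hG.pos_dist_of_ne hne
    rw [Set.mem_compl_iff, mem_geodesicCone, dist_self]
    omega
  · obtain ⟨w', hadj, hdist⟩ := exists_adj_dist_add_one_eq (hG.pos_dist_of_ne hwρ.symm).ne'
    refine ⟨w', fun hw' => hw ?_, hadj, by omega⟩
    have hstep := hadj.diff_dist_adj (u := v)
    have htri := hG.dist_triangle (u := ρ) (v := v) (w := w)
    rw [mem_geodesicCone] at hw' ⊢
    omega

theorem sum_dist_add_two_mul_ncard_geodesicCone_le [Fintype V] {a b : V} (hadj : G.Adj a b) :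
    ∑ v, G.dist b v + 2 * (geodesicCone G a b).ncard ≤ ∑ v, G.dist a v + Fintype.card V := by
  classical
  have hcone : 2 * (geodesicCone G a b).ncard =
      ∑ v, if v ∈ geodesicCone G a b then 2 else 0 := by
    rw [← sum_filter, sum_const, smul_eq_mul, mul_comm, Set.ncard_eq_toFinset_card',
      Set.filter_mem_univ_eq_toFinset]
  rw [hcone, Fintype.card_eq_sum_ones, ← sum_add_distrib, ← sum_add_distrib]
  refine sum_le_sum fun v _ => ?_
  have hstep := hadj.diff_dist_adj (u := v)
  rw [dist_comm (u := v), dist_comm (u := v)] at hstep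
  split_ifs with hv
  · rw [mem_geodesicCone, dist_eq_one_iff_adj.2 hadj] at hv
    omega
  · omega

theorem exists_forall_two_mul_dist_le_card [Finite V] (hG : G.Connected) :
    ∃ c, ∀ v, 2 * G.dist c v ≤ Nat.card V := by
  cases nonempty_fintype V
  have := hG.nonempty
  -- A vertex minimizing the sum of distances is a possible centre.
  obtain ⟨c, hc⟩ := Finite.exists_min fun c => ∑ v, G.dist c v
  refine ⟨c, fun u => ?_⟩
  by_contra! hu
  obtain ⟨b, hb, hcard⟩ :=
    exists_lt_ncard_geodesicCone hG (ρ := c) (u := u) (r := G.dist c u - 1) (by omega)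
  have hadj : G.Adj c b := dist_eq_one_iff_adj.1 (by omega)
  have hsum := sum_dist_add_two_mul_ncard_geodesicCone_le hadj
  have hmin := hc b
  rw [Nat.card_eq_fintype_card] at hu
  omega

theorem exists_forall_dist_le_or_connected_induce [Finite V] (hG : G.Connected) (r : ℕ) :
    (∃ c, ∀ v, G.dist c v ≤ r) ∨ ∃ (x : V) (S : Set V), (G.induce S).Connected ∧
      (∀ v ∉ S, G.dist x v ≤ r) ∧ S.ncard + r < Nat.card V := by
  have := hG.nonempty
  obtain ⟨ρ⟩ := hG.nonempty
  obtain ⟨u, hu⟩ := Finite.exists_max (G.dist ρ)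
  by_cases hclose : G.dist ρ u ≤ r
  · exact Or.inl ⟨ρ, fun v => (hu v).trans hclose⟩
  obtain ⟨x, hx, hlt⟩ := exists_lt_ncard_geodesicCone hG (not_le.1 hclose).le
  have hne : ρ ≠ x := by
    rintro rfl
    rw [SimpleGraph.dist_self] at hx
    omega
  have hcompl := Set.ncard_add_ncard_compl (geodesicCone G ρ x)
  refine Or.inr ⟨x, (geodesicCone G ρ x)ᶜ, induce_compl_geodesicCone_connected hG hne,
    fun v hv => ?_, by omega⟩
  have hmax := hu v
  rw [Set.notMem_compl_iff, mem_geodesicCone] at hv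
  omega

end GeodesicCone

section BallCover

variable {V ι : Type*} {G : SimpleGraph V} {S : Set V} {s : Finset ι} {r : ι → ℕ}

/-- The balls with centres `c i` and radii `r i`, for `i ∈ s`, cover the graph. The graph is meant
to be connected, since `SimpleGraph.dist` is `0` between different components. -/
def IsBallCover (G : SimpleGraph V) (s : Finset ι) (r : ι → ℕ) (c : ι → V) : Prop :=
  ∀ v, ∃ i ∈ s, G.dist (c i) v ≤ r i

theorem IsBallCover.update_of_induce [DecidableEq ι] {i : ι} {c : ι → S} {x : V}
    (hc : IsBallCover (G.induce S) (s.erase i) r c) (hS : (G.induce S).Connected) (hi : i ∈ s)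
    (hx : ∀ v ∉ S, G.dist x v ≤ r i) :
    IsBallCover G s r (Function.update (fun a => (c a : V)) i x) := by
  intro v
  by_cases hv : v ∈ S
  · obtain ⟨a, ha, hdist⟩ := hc ⟨v, hv⟩
    refine ⟨a, mem_of_mem_erase ha, ?_⟩
    rw [Function.update_of_ne (ne_of_mem_erase ha)]
    exact (dist_le_dist_induce (hS _ _)).trans hdist
  · exact ⟨i, hi, by simpa using hx v hv⟩

theorem IsBallCover.thicken_of_induce {c : ι → S} {d : ℕ} (hc : IsBallCover (G.induce S) s r c)
    (hS : (G.induce S).Connected) (hG : G.Connected) (hd : ∀ v, ∃ w ∈ S, G.dist w v ≤ d) :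
    IsBallCover G s (fun i => r i + d) (fun i => (c i : V)) := by
  intro v
  obtain ⟨w, hw, hwv⟩ := hd v
  obtain ⟨i, hi, hiw⟩ := hc ⟨w, hw⟩
  refine ⟨i, hi, ?_⟩
  calc
    G.dist (c i) v ≤ G.dist (c i) w + G.dist w v := hG.dist_triangle
    _ ≤ r i + d := Nat.add_le_add ((dist_le_dist_induce (hS _ ⟨w, hw⟩)).trans hiw) hwv

theorem exists_isBallCover [Finite V] (hG : G.Connected) {j : ι} (hj : j ∈ s)
    (hcard : Nat.card V ≤ ∑ i ∈ s, (r i + 1) + r j) : ∃ c, IsBallCover G s r c := by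
  classical
  induction s using Finset.strongInduction generalizing V with
  | H s ih =>
    obtain rfl | hs := eq_singleton_or_nontrivial hj
    · rw [sum_singleton] at hcard
      obtain ⟨c, hc⟩ := exists_forall_two_mul_dist_le_card hG
      exact ⟨fun _ => c, fun v => ⟨j, hj, (show G.dist c v ≤ r j by have := hc v; omega)⟩⟩
    obtain ⟨i, hi, hij⟩ := hs.exists_ne j
    obtain ⟨c, hc⟩ | ⟨x, S, hS, hx, hlt⟩ := exists_forall_dist_le_or_connected_induce hG (r i)
    · exact ⟨fun _ => c, fun v => ⟨i, hi, hc v⟩⟩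
    rw [← add_sum_erase s _ hi] at hcard
    obtain ⟨c, hc⟩ := ih (s.erase i) (erase_ssubset hi) hS (mem_erase.2 ⟨hij.symm, hj⟩)
      (by rw [Nat.card_coe_set_eq]; omega)
    exact ⟨_, hc.update_of_induce hS hi hx⟩

end BallCover

section Burning

variable {V : Type*} {G : SimpleGraph V} {k : ℕ}

theorem burned_snoc_succ (x : Fin k → V) (w : V) :
    G.burned (Fin.snoc x w : Fin (k + 1) → V) (k + 1) =
      G.burned x k ∪ {v | ∃ u ∈ G.burned x k, G.Adj u v} ∪ {w} := by
  rw [burned, burned_snoc G x w le_rfl]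
  congr 1
  ext v
  constructor
  · rintro ⟨i, hi, rfl⟩
    obtain rfl : i = Fin.last k := Fin.ext hi
    simp
  · rintro rfl
    exact ⟨Fin.last k, rfl, Fin.snoc_last _ _⟩

theorem snoc_notMem_burned {x : Fin k → V} {w : V} (hx : ∀ i : Fin k, x i ∉ G.burned x i)
    (hw : w ∉ G.burned x k) (i : Fin (k + 1)) :
    (Fin.snoc x w : Fin (k + 1) → V) i ∉ G.burned (Fin.snoc x w : Fin (k + 1) → V) i := by
  rw [burned_snoc G x w (Nat.lt_succ_iff.1 i.2)]
  cases i using Fin.lastCases with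
  | last => simpa using hw
  | cast j => simpa using hx j

theorem burningNumber_le_of_isBurningSequence {x : Fin k → V} (hx : G.IsBurningSequence x) :
    G.burningNumber ≤ k :=
  Nat.sInf_le ⟨x, hx⟩

theorem exists_unburned_sources_of_le_burningNumber (hk : k ≤ G.burningNumber) (y : Fin k → V) :
    ∃ x : Fin k → V, (∀ i : Fin k, x i ∉ G.burned x i) ∧ G.burned y k ⊆ G.burned x k := by
  induction y using Fin.snocInduction with
  | elim0 => exact ⟨Fin.elim0, fun i => i.elim0, subset_rfl⟩
  | @snoc k y z ih =>
    obtain ⟨x, hx, hyx⟩ := ih (by omega)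
    have hne : G.burned x k ≠ Set.univ := fun h =>
      absurd (burningNumber_le_of_isBurningSequence ⟨hx, h⟩) (by omega)
    -- The planned source is kept if it is unburned, and replaced by any unburned vertex otherwise.
    obtain ⟨w, hw, hzw⟩ : ∃ w ∉ G.burned x k, z ∈ G.burned x k ∪ {w} := by
      by_cases hz : z ∈ G.burned x k
      · obtain ⟨w, hw⟩ := (Set.ne_univ_iff_exists_notMem _).1 hne
        exact ⟨w, hw, Or.inl hz⟩
      · exact ⟨z, hz, Or.inr rfl⟩
    refine ⟨Fin.snoc x w, snoc_notMem_burned hx hw, ?_⟩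
    rw [burned_snoc_succ, burned_snoc_succ]
    rintro v ((hv | ⟨u, hu, hadj⟩) | rfl)
    · exact Or.inl (Or.inl (hyx hv))
    · exact Or.inl (Or.inr ⟨u, hyx hu, hadj⟩)
    · exact hzw.imp_left Or.inl

theorem burningNumber_le_of_burned_eq_univ {y : Fin k → V} (hy : G.burned y k = Set.univ) :
    G.burningNumber ≤ k := by
  by_contra! hlt
  obtain ⟨x, hx, hyx⟩ := exists_unburned_sources_of_le_burningNumber hlt.le y
  rw [hy, Set.univ_subset_iff] at hyx
  exact hlt.not_ge (burningNumber_le_of_isBurningSequence ⟨hx, hyx⟩)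

theorem mem_burned_of_add_dist_lt {x : Fin k → V} {i : Fin k} {v : V} {t : ℕ}
    (hreach : G.Reachable (x i) v) (ht : i + G.dist (x i) v < t) : v ∈ G.burned x t := by
  induction t generalizing v with
  | zero => omega
  | succ t ih =>
    by_cases hlt : i + G.dist (x i) v < t
    · exact Or.inl (Or.inl (ih hreach hlt))
    by_cases hdist : G.dist (x i) v = 0
    · exact Or.inr ⟨i, by omega, hreach.dist_eq_zero_iff.1 hdist⟩
    · obtain ⟨u, hadj, hu⟩ := exists_adj_dist_add_one_eq hdist
      exact Or.inl (Or.inr ⟨u, ih (hreach.trans hadj.symm.reachable) (by omega), hadj⟩)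

theorem IsBallCover.burningNumber_le {c : ℕ → V} (hc : IsBallCover G (range k) id c)
    (hG : G.Connected) : G.burningNumber ≤ k := by
  refine burningNumber_le_of_burned_eq_univ (y := fun i : Fin k => c (k - 1 - i)) ?_
  refine Set.eq_univ_of_forall fun v => ?_
  obtain ⟨i, hi, hdist⟩ := hc v
  rw [mem_range] at hi
  refine mem_burned_of_add_dist_lt (i := ⟨k - 1 - i, by omega⟩) (hG _ _) ?_
  simp only [id_eq, show k - 1 - (k - 1 - i) = i by omega] at hdist ⊢
  omega

theorem burningNumber_le_of_card_lt_two_mul [Finite V] (hG : G.Connected)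
    (hk : Nat.card V < 2 * k) : G.burningNumber ≤ k := by
  obtain ⟨c, hc⟩ := exists_forall_two_mul_dist_le_card hG
  have hrad : ∀ v, G.dist c v ≤ k - 1 := fun v => by
    have := hc v
    omega
  exact IsBallCover.burningNumber_le (c := fun _ => c)
    (fun v => ⟨k - 1, mem_range.2 (by omega), hrad v⟩) hG

theorem burningNumber_le_of_connected_dominating [Finite V] (hG : G.Connected) {S : Set V}
    (hS : (G.induce S).Connected) (hdom : ∀ v, ∃ w ∈ S, G.dist w v ≤ 1)
    (hk : 2 * S.ncard + 4 ≤ k * (k + 1)) : G.burningNumber ≤ k := by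
  obtain ⟨l, rfl⟩ : ∃ l, k = l + 2 := by
    refine Nat.exists_eq_add_of_le' ?_
    by_contra! h
    interval_cases k <;> omega
  have hsum : (∑ i ∈ range (l + 1), (i + 1)) * 2 = (l + 2) * (l + 1) := by
    have h := sum_range_id_mul_two (l + 2)
    rwa [sum_range_succ'] at h
  have hcard : Nat.card S ≤ ∑ i ∈ range (l + 1), (id i + 1) + id l := by
    rw [Nat.card_coe_set_eq]
    simp only [id_eq]
    linarith
  obtain ⟨c, hc⟩ := exists_isBallCover hS (self_mem_range_succ l) hcard
  refine IsBallCover.burningNumber_le (c := fun i => (c (i - 1) : V)) (fun v => ?_) hG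
  obtain ⟨i, hi, hdist⟩ := hc.thicken_of_induce hS hG hdom v
  exact ⟨i + 1, mem_range.2 (Nat.succ_lt_succ (mem_range.1 hi)), hdist⟩

end Burning

section Leaves

variable {V : Type*} {G : SimpleGraph V}

theorem subsingleton_neighborSet_of_degree_le_one {v : V} [Fintype (G.neighborSet v)]
    (hv : G.degree v ≤ 1) : (G.neighborSet v).Subsingleton := by
  rw [← card_neighborFinset_eq_degree, card_le_one_iff_subsingleton, coe_neighborFinset] at hv
  exact hv

theorem induce_connected_of_one_lt_degree_subset [G.LocallyFinite] (hG : G.Connected)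
    {S : Set V} (hne : S.Nonempty) (hS : {v | 1 < G.degree v} ⊆ S) : (G.induce S).Connected := by
  have : Nonempty S := hne.to_subtype
  exact ⟨hG.preconnected.induce_of_degree_eq_one fun v hv =>
    subsingleton_neighborSet_of_degree_le_one (not_lt.1 fun h => hv (hS h))⟩

variable [Fintype V] [DecidableRel G.Adj]

theorem exists_one_lt_degree (hG : G.Connected) (hcard : 2 < Fintype.card V) :
    ∃ v, 1 < G.degree v := by
  by_contra! hle
  have hsum : ∑ v, G.degree v ≤ Fintype.card V := by
    simpa using sum_le_sum fun v (_ : v ∈ univ) => hle v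
  have hedges := hG.card_vert_le_card_edgeSet_add_one
  rw [sum_degrees_eq_twice_card_edges] at hsum
  rw [Nat.card_eq_fintype_card, Nat.card_eq_fintype_card, ← edgeFinset_card] at hedges
  omega

theorem exists_one_lt_degree_dist_le_one (hG : G.Connected) (hcard : 2 < Fintype.card V) (v : V) :
    ∃ w, 1 < G.degree w ∧ G.dist w v ≤ 1 := by
  by_cases hv : 1 < G.degree v
  · exact ⟨v, hv, by simp⟩
  obtain ⟨ρ, hρ⟩ := exists_one_lt_degree hG hcard
  -- `v` has a neighbour in the connected graph induced on the inner vertices and `v`.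
  have hconn := induce_connected_of_one_lt_degree_subset hG
    (Set.insert_nonempty v {w | 1 < G.degree w}) (Set.subset_insert _ _)
  have hne : v ≠ ρ := by
    rintro rfl
    exact hv hρ
  have := (Set.nontrivial_of_mem_mem_ne (Set.mem_insert v {w | 1 < G.degree w})
    (Set.mem_insert_of_mem _ hρ) hne).coe_sort
  obtain ⟨⟨w, hw⟩, hadj⟩ := hconn.preconnected.exists_adj_of_nontrivial ⟨v, Set.mem_insert _ _⟩
  have hvw : G.Adj v w := hadj
  exact ⟨w, hw.resolve_left hvw.ne', (dist_eq_one_iff_adj.2 hvw.symm).le⟩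

end Leaves

section Tree

variable {V : Type*} [Fintype V] {T : SimpleGraph V} [DecidableRel T.Adj]

theorem two_mul_ncard_one_lt_degree_add_two_le (hT : T.IsTree) (hdeg : ∀ v, T.degree v ≠ 2)
    (hcard : 2 ≤ Fintype.card V) : 2 * {v | 1 < T.degree v}.ncard + 2 ≤ Fintype.card V := by
  have : Nontrivial V := Fintype.one_lt_card_iff_nontrivial.1 hcard
  have hncard : {v | 1 < T.degree v}.ncard = ∑ v, if 1 < T.degree v then 1 else 0 := by
    rw [Set.ncard_eq_toFinset_card', Set.toFinset_ofPred, card_filter]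
  have hsum : Fintype.card V + 2 * {v | 1 < T.degree v}.ncard ≤ ∑ v, T.degree v := by
    rw [hncard, Fintype.card_eq_sum_ones, mul_sum, ← sum_add_distrib]
    refine sum_le_sum fun v _ => ?_
    have hpos := hT.connected.preconnected.degree_pos_of_nontrivial v
    have hne := hdeg v
    split_ifs <;> omega
  have hedges := hT.card_edgeFinset
  rw [sum_degrees_eq_twice_card_edges] at hsum
  omega

theorem burningNumber_le_of_isTree_of_forall_degree_ne_two (hT : T.IsTree)
    (hdeg : ∀ v, T.degree v ≠ 2) {k : ℕ} (hk : Fintype.card V < k * (k + 1)) :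
    T.burningNumber ≤ k := by
  have hG := hT.connected
  obtain hsmall | hlarge := le_or_gt (Fintype.card V) 2
  · refine burningNumber_le_of_card_lt_two_mul hG ?_
    rw [Nat.card_eq_fintype_card]
    by_contra! h
    have : k ≤ 1 := by omega
    interval_cases k <;> omega
  have hinner := two_mul_ncard_one_lt_degree_add_two_le hT hdeg hlarge.le
  obtain ⟨a, ha⟩ := Nat.even_mul_succ_self k
  exact burningNumber_le_of_connected_dominating hG
    (induce_connected_of_one_lt_degree_subset hG (S := {v | 1 < T.degree v})
      (exists_one_lt_degree hG hlarge) subset_rfl)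
    (exists_one_lt_degree_dist_le_one hG hlarge) (by omega)

end Tree

theorem lt_ceil_sqrt_mul_succ {n m : ℕ} (hn : m * (m + 1) < n) :
    n < ⌈√((n : ℝ) - m)⌉₊ * (⌈√((n : ℝ) - m)⌉₊ + 1) := by
  set k := ⌈√((n : ℝ) - m)⌉₊
  have hsq : (n : ℝ) - m ≤ (k : ℝ) ^ 2 := (Real.sqrt_le_left k.cast_nonneg).1 (Nat.le_ceil _)
  have hle : n ≤ k ^ 2 + m := by
    rw [sub_le_iff_le_add] at hsq
    exact_mod_cast hsq
  have hmk : m < k := by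
    by_contra! h
    nlinarith
  nlinarith

end GraphBurning

theorem mainTheorem2 {V : Type*} [Fintype V] (T : SimpleGraph V) [DecidableRel T.Adj]
    (hT : T.IsTree) (hdeg : ∀ v : V, T.degree v ≠ 2) (n m : ℕ) (hcard : Fintype.card V = n)
    (hn : m * (m + 1) + 1 ≤ n) :
    T.burningNumber ≤ ⌈((n : ℝ) - (m : ℝ)) ^ (1 / 2 : ℝ)⌉₊ := by
  subst hcard
  rw [← Real.sqrt_eq_rpow]
  exact GraphBurning.burningNumber_le_of_isTree_of_forall_degree_ne_two hT hdeg
    (GraphBurning.lt_ceil_sqrt_mul_succ hn)
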